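/- **Setting.** Trees are finite, nonempty, ordered, unranked and labeled by a finite alphabet $\Sigma$. A strongly deterministic unranked tree automaton (SDTA) $A$ over $\Sigma$ consists of a finite set $Q$ of vertical states, a set $F\subseteq Q$ of final states and, for every $\sigma\in\Sigma$, one (not necessarily complete) DFA over the alphabet $Q\sqcup\Sigma$ with finite set $C_\sigma$ of horizontal states, initial state $c_{\sigma,0}\in C_\sigma$, partial transition function $\gamma_\sigma$ and set of final states $E_\sigma\subseteq C_\sigma$, together with an output function $\lambda_\sigma:E_\sigma\to Q$. A node labeled $\sigma$ with children $u_1,\dots,u_r$ ($r\ge 0$) is assigned the state $\lambda_\sigma(c)$ if $x_1\cdots x_r$ leads from $c_{\sigma,0}$ to some $c\in E_\sigma$, where $x_i$ is the label of $u_i$ if $u_i$ is a leaf and is the state assigned to $u_i$ otherwise; if some $x_i$ or the run is undefined, or the run ends outside $E_\sigma$, no state is assigned. The language $L(A)$ consists of the trees whose root is assigned a state in $F$. The number of vertical states is $|Q|$, the number of horizontal states is $\sum_{\sigma\in\Sigma}|C_\sigma|$. **Theorem 3.1.** Let $A_1,A_2$ be SDTAs over a finite alphabet $\Sigma$, with vertical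 states $Q_i$ and horizontal states $C^i_\sigma$ ($\sigma\in\Sigma$), $i=1,2$. 1. There is an SDTA recognizing $L(A_1)\cup L(A_2)$ with at most $(|Q_1|+1)(|Q_2|+1)-1$ vertical states and at most $\sum_{\sigma\in\Sigma}\bigl((|C^1_\sigma|+1)(|C^2_\sigma|+1)-1\bigr)$ horizontal states. 2. There is an SDTA recognizing $L(A_1)\cap L(A_2)$ with at most $|Q_1|\,|Q_2|$ vertical states and at most $\sum_{\sigma\in\Sigma}|C^1_\sigma|\,|C^2_\sigma|$ horizontal states. 3. There are a finite alphabet $\Sigma_0$ and a constant $c$ such that for all integers $m,n\ge 1$ and all pairwise coprime positive integers $k_1,\dots,k_{m+n}$ there are tree languages $T_1,T_2$ over $\Sigma_0$ with the following properties. $T_1$ is recognized by an SDTA with exactly $m$ vertical states whose number $h_1$ of horizontal states satisfies $|h_1-\prod_{i=1}^m k_i|\le cm$, and $T_2$ by an SDTA with exactly $n$ vertical states whose number $h_2$ of horizontal states satisfies $|h_2-\prod_{i=m+1}^{m+n}k_i|\le cn$. Moreover: (i) every SDTA over $\Sigma_0$ recognizing $T_1\cup T_2$ has at least $(m+1)(n+1)-1$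 vertical states and at least $\prod_{i=1}^{m+n}k_i$ horizontal states; (ii) every SDTA over $\Sigma_0$ recognizing $T_1\cap T_2$ has at least $mn$ vertical states and at least $\prod_{i=1}^{m+n}k_i$ horizontal states. -/

import Mathlib

/-- Finite, nonempty, ordered, unranked trees with node labels in `α`: a node carries a label and
an arbitrary finite sequence of subtrees. A node without subtrees is a leaf. -/
inductive UTree (α : Type*) where
  | node (label : α) (children : List (UTree α)) : UTree α

/-- A strongly deterministic unranked tree automaton (SDTA) over the alphabet `α`, not required
to be complete. `Q` is the finite set of vertical states and `final` the set of final ones. For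
each label `a` there is a single horizontal DFA with the finite set of states `S a`, the initial
state `start a` and the partial transition function `step a`, reading words over the disjoint
union of `Q` and `α`; it carries an output function `out a`, which is defined exactly on the final
states of the DFA and takes values in `Q`. -/
structure SDTA (α : Type*) where
  Q : Type
  finite_Q : Finite Q
  final : Set Q
  S : α → Type
  finite_S : ∀ a, Finite (S a)
  start : ∀ a, S a
  step : ∀ a, S a → Q ⊕ α → Option (S a)
  out : ∀ a, S a → Option Q

namespace SDTA

variable {α : Type*} (A : SDTA α)

/-- The vertical state assigned to a word by the horizontal DFA of the label `a`, if any: the word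
is read from the initial state, and the output function is applied to the state reached. Thus the
horizontal language of `q` and `a` is `{w | A.output a w = some q}`. -/
def output (a : α) (w : List (A.Q ⊕ α)) : Option A.Q :=
  (w.foldlM (A.step a) (A.start a)).bind (A.out a)

mutual

/-- The letter that a child contributes to the word read at its parent: a leaf contributes its
label, and any other node contributes the vertical state assigned to it, if there is one. -/
def letter : UTree α → Option (A.Q ⊕ α)
  | .node a [] => some (.inr a)
  | .node a (t :: ts) => ((word (t :: ts)).bind (A.output a)).map .inl

/-- The word of the letters of a sequence of children, undefined if one of them is. -/
def word : List (UTree α) → Option (List (A.Q ⊕ α))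
  | [] => some []
  | t :: ts => (letter t).bind fun x => (word ts).map (x :: ·)

end

/-- The vertical state assigned to the root of a tree, if any. -/
def state : UTree α → Option A.Q
  | .node a ts => (A.word ts).bind (A.output a)

theorem letter_leaf (a : α) : A.letter (.node a []) = some (.inr a) := by
  rw [letter]

theorem letter_of_ne_nil (a : α) {ts : List (UTree α)} (h : ts ≠ []) :
    A.letter (.node a ts) = (A.state (.node a ts)).map .inl := by
  cases ts with
  | nil => exact absurd rfl h
  | cons t ts => rw [letter, state]

/-- The tree language recognized by the automaton. -/
def language : Set (UTree α) := {t | ∃ q ∈ A.final, A.state t = some q}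

/-- The number of vertical states. -/
noncomputable def numVertical : ℕ := Nat.card A.Q

/-- The number of states of the horizontal DFA of the label `a`. -/
noncomputable def numHorizontalAt (a : α) : ℕ := Nat.card (A.S a)

/-- The total number of horizontal states. -/
noncomputable def numHorizontal [Fintype α] : ℕ := ∑ a, A.numHorizontalAt a

end SDTA

-- The upper bounds come from running both automata in parallel. For the intersection both runs must
-- be defined; for the union one may fail, so the states are pairs of optional states other than
-- (undefined, undefined). `state_eq_of_simulation` covers both cases.
--
-- The lower bounds use modular counters. A node labeled `0` with r leaf children gets state 0
-- exactly when K ∣ r; above it, unary labels act on the state: each automaton has a label that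
-- increments it and one that makes it fail, and both labels preserve the state of the other
-- automaton. Unary contexts then make a Myhill–Nerode argument work: any automaton for the union
-- must distinguish all (m+1)(n+1) pairs of optional states on branching trees, and any automaton
-- for the intersection all mn defined pairs and failure. At most one class can have no state, which
-- costs the 1 in both counts. Horizontally, when K and L are coprime, such an automaton must count
-- leaves modulo KL.

namespace UTree

variable {α : Type*}

theorem induction_children {P : UTree α → Prop}
    (h : ∀ a ts, (∀ t ∈ ts, P t) → P (.node a ts)) : ∀ t, P t
  | .node a ts => h a ts fun t _ => induction_children h t
decreasing_by
  have := List.sizeOf_lt_of_mem ‹t ∈ ts›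
  simp only [UTree.node.sizeOf_spec]
  omega

/-- A tree is branching if its root is not a leaf. -/
def Branching : UTree α → Prop
  | .node _ ts => ts ≠ []

/-- The tree with root label `a` and the single child `t`. -/
def unary (a : α) (t : UTree α) : UTree α := .node a [t]

theorem branching_unary (a : α) (t : UTree α) : (unary a t).Branching := by
  simp [unary, Branching]

theorem branching_iterate_unary (a : α) {t : UTree α} (ht : t.Branching) (p : ℕ) :
    ((unary a)^[p] t).Branching := by
  cases p with
  | zero => exact ht
  | succ p =>
    rw [Function.iterate_succ_apply']
    exact branching_unary _ _

/-- The tree whose root is labeled `a` and has `r` leaves labeled `a` as children. -/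
def broom (a : α) (r : ℕ) : UTree α := .node a (List.replicate r (.node a []))

theorem branching_broom (a : α) {r : ℕ} (hr : r ≠ 0) : (broom a r).Branching := by
  simp [broom, Branching, hr]

end UTree

open UTree

namespace SDTA

variable {α : Type*}

-- Runs, congruence under unary contexts, and counting states

section Basic

variable (A : SDTA α)

theorem letter_of_branching {t : UTree α} (ht : t.Branching) :
    A.letter t = (A.state t).map .inl := by
  obtain ⟨a, ts⟩ := t
  exact A.letter_of_ne_nil a ht

/-- The horizontal state reached from an optional horizontal state by reading the letters of a
sequence of children. -/
def run (a : α) (ts : List (UTree α)) (c : Option (A.S a)) : Option (A.S a) :=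
  c.bind fun c => (A.word ts).bind fun w => w.foldlM (A.step a) c

theorem run_nil (a : α) (c : Option (A.S a)) : A.run a [] c = c := by
  cases c <;> simp [run, word]

theorem run_cons (a : α) (t : UTree α) (ts : List (UTree α)) (c : Option (A.S a)) :
    A.run a (t :: ts) c = A.run a ts (c.bind fun c => (A.letter t).bind (A.step a c)) := by
  cases c with
  | none => simp [run]
  | some c =>
    simp only [run, word, Option.bind_some]
    cases A.letter t with
    | none => simp
    | some x =>
      cases hw : A.word ts with
      | none => simp
      | some w => simp

theorem state_node (a : α) (ts : List (UTree α)) :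
    A.state (.node a ts) = (A.run a ts (some (A.start a))).bind (A.out a) := by
  simp [state, run, output, Option.bind_assoc]
  rfl

theorem run_replicate_add (a b : α) (r s : ℕ) (c : Option (A.S a)) :
    A.run a (List.replicate (r + s) (.node b [])) c =
      A.run a (List.replicate s (.node b [])) (A.run a (List.replicate r (.node b [])) c) := by
  induction r generalizing c with
  | zero => simp [run_nil]
  | succ r ih => rw [Nat.add_right_comm, List.replicate_succ, List.replicate_succ, run_cons,
      run_cons, ih]

/-- Branching is essential: a leaf passes its label, not its state, to the parent. -/
theorem state_unary_congr (a : α) {t t' : UTree α} (ht : t.Branching) (ht' : t'.Branching)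
    (h : A.state t = A.state t') : A.state (unary a t) = A.state (unary a t') := by
  simp [unary, state_node, run_cons, A.letter_of_branching ht, A.letter_of_branching ht', h]

theorem state_iterate_unary_congr (a : α) {t t' : UTree α} (ht : t.Branching)
    (ht' : t'.Branching) (h : A.state t = A.state t') (p : ℕ) :
    A.state ((unary a)^[p] t) = A.state ((unary a)^[p] t') := by
  induction p with
  | zero => exact h
  | succ p ih =>
    rw [Function.iterate_succ_apply', Function.iterate_succ_apply']
    exact A.state_unary_congr a (branching_iterate_unary a ht p)
      (branching_iterate_unary a ht' p) ih

theorem state_unary_eq_none (a : α) {t : UTree α} (ht : t.Branching) (h : A.state t = none) :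
    A.state (unary a t) = none := by
  rw [unary, state_node, run_cons, A.letter_of_branching ht, h, run_nil]
  rfl

theorem mem_language_congr {t t' : UTree α} (h : A.state t = A.state t') :
    t ∈ A.language ↔ t' ∈ A.language := by
  simp [language, h]

/-- An invariant with values in a finite type, which takes each of its values on a branching tree
and is determined by the state, bounds the number of vertical states from below. -/
theorem card_le_numVertical_add_one {β : Type*} (g : UTree α → β)
    (hg : ∀ b, ∃ t : UTree α, t.Branching ∧ g t = b)
    (h : ∀ t t' : UTree α, t.Branching → t'.Branching → A.state t = A.state t' → g t = g t') :
    Nat.card β ≤ A.numVertical + 1 := by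
  have := A.finite_Q
  choose τ hτ hgτ using hg
  -- The injection goes into optional states: one value may be represented by a tree without a
  -- state, hence the `+ 1`.
  have hinj : Function.Injective fun b => A.state (τ b) := fun b b' hb => by
    rw [← hgτ b, ← hgτ b', h _ _ (hτ b) (hτ b') hb]
  simpa [numVertical, Finite.card_option] using Nat.card_le_card_of_injective _ hinj

end Basic

-- Product automata and the upper bounds

section Product

/-- If optional states of `A₁` and `A₂` are combined to optional states of `B` compatibly with
transitions and outputs, then so are the states assigned to trees. -/
theorem state_eq_of_simulation {A₁ A₂ B : SDTA α}
    (φ : Option A₁.Q → Option A₂.Q → Option B.Q)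
    (ψ : ∀ a, Option (A₁.S a) → Option (A₂.S a) → Option (B.S a))
    (hstart : ∀ a, ψ a (some (A₁.start a)) (some (A₂.start a)) = some (B.start a))
    (hinr : ∀ a b c₁ c₂, ((ψ a c₁ c₂).bind fun c => B.step a c (.inr b)) =
      ψ a (c₁.bind fun c => A₁.step a c (.inr b)) (c₂.bind fun c => A₂.step a c (.inr b)))
    (hinl : ∀ a q₁ q₂ c₁ c₂,
      ((ψ a c₁ c₂).bind fun c => (φ q₁ q₂).bind fun q => B.step a c (.inl q)) =
      ψ a (c₁.bind fun c => q₁.bind fun q => A₁.step a c (.inl q))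
        (c₂.bind fun c => q₂.bind fun q => A₂.step a c (.inl q)))
    (hout : ∀ a c₁ c₂, (ψ a c₁ c₂).bind (B.out a) =
      φ (c₁.bind (A₁.out a)) (c₂.bind (A₂.out a)))
    (t : UTree α) : B.state t = φ (A₁.state t) (A₂.state t) := by
  induction t using UTree.induction_children with
  | h a ts ih =>
    -- Arbitrary optional states are needed, since one run may have failed while the other
    -- continues.
    have key : ∀ c₁ c₂, B.run a ts (ψ a c₁ c₂) = ψ a (A₁.run a ts c₁) (A₂.run a ts c₂) := by
      clear hstart hout
      induction ts with
      | nil => simp [run_nil]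
      | cons t ts iht =>
        intro c₁ c₂
        have hstep : ((ψ a c₁ c₂).bind fun c => (B.letter t).bind (B.step a c)) =
            ψ a (c₁.bind fun c => (A₁.letter t).bind (A₁.step a c))
              (c₂.bind fun c => (A₂.letter t).bind (A₂.step a c)) := by
          obtain ⟨b, us⟩ := t
          by_cases hus : us = []
          · subst hus
            simpa [letter_leaf] using hinr a b c₁ c₂
          · simpa [letter_of_ne_nil _ _ hus, ih _ List.mem_cons_self, Option.bind_map,
              Function.comp_def] using hinl a _ _ c₁ c₂
        rw [run_cons, run_cons, run_cons, hstep]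
        exact iht (fun t ht => ih t (List.mem_cons_of_mem _ ht)) _ _
    rw [state_node, state_node, state_node, ← hstart, key, hout]

/-- The product automaton, which runs two automata in parallel as long as both are defined. -/
def inter (A₁ A₂ : SDTA α) : SDTA α where
  Q := A₁.Q × A₂.Q
  finite_Q := have := A₁.finite_Q; have := A₂.finite_Q; inferInstance
  final := A₁.final ×ˢ A₂.final
  S a := A₁.S a × A₂.S a
  finite_S a := have := A₁.finite_S a; have := A₂.finite_S a; inferInstance
  start a := (A₁.start a, A₂.start a)
  step a c x := Option.map₂ Prod.mk (A₁.step a c.1 (x.map Prod.fst id))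
    (A₂.step a c.2 (x.map Prod.snd id))
  out a c := Option.map₂ Prod.mk (A₁.out a c.1) (A₂.out a c.2)

theorem state_inter (A₁ A₂ : SDTA α) (t : UTree α) :
    (A₁.inter A₂).state t = Option.map₂ Prod.mk (A₁.state t) (A₂.state t) := by
  refine state_eq_of_simulation (B := A₁.inter A₂) (Option.map₂ Prod.mk)
    (fun _ => Option.map₂ Prod.mk) (fun _ => rfl) ?_ ?_ ?_ t
  · rintro a b (_ | c₁) (_ | c₂) <;> simp [inter]
  · rintro a (_ | q₁) (_ | q₂) (_ | c₁) (_ | c₂) <;> simp [inter]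
  · rintro a (_ | c₁) (_ | c₂) <;> simp [inter]

theorem language_inter (A₁ A₂ : SDTA α) :
    (A₁.inter A₂).language = A₁.language ∩ A₂.language := by
  ext t
  constructor
  · rintro ⟨q, ⟨h₁, h₂⟩, hq⟩
    obtain ⟨q₁, q₂, hq₁, hq₂, rfl⟩ :=
      Option.map₂_eq_some_iff.1 ((state_inter A₁ A₂ t).symm.trans hq)
    exact ⟨⟨q₁, h₁, hq₁⟩, ⟨q₂, h₂, hq₂⟩⟩
  · rintro ⟨⟨q₁, h₁, hq₁⟩, ⟨q₂, h₂, hq₂⟩⟩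
    exact ⟨(q₁, q₂), ⟨h₁, h₂⟩, (state_inter A₁ A₂ t).trans
      (Option.map₂_eq_some_iff.2 ⟨q₁, q₂, hq₁, hq₂, rfl⟩)⟩

/-- Pairs of optional elements which are not both undefined. -/
abbrev OptionPair (X Y : Type) : Type := {p : Option X × Option Y // p ≠ (none, none)}

open Classical in
/-- The pair of two optional elements, undefined if both are. -/
noncomputable def optionPair {X Y : Type} (x : Option X) (y : Option Y) :
    Option (OptionPair X Y) :=
  if h : (x, y) ≠ (none, none) then some ⟨(x, y), h⟩ else none

theorem optionPair_eq_some_iff {X Y : Type} {x : Option X} {y : Option Y} {p : OptionPair X Y} :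
    optionPair x y = some p ↔ p.1 = (x, y) := by
  obtain ⟨p, hp⟩ := p
  unfold optionPair
  split_ifs with h
  · simp [eq_comm]
  · simp only [ne_eq, not_not] at h
    simp [h, hp]

/-- Reduces the simulation conditions for the union to existing pairs; `hg` handles the excluded
pair, where both runs have failed. -/
theorem optionPair_bind {X Y Z : Type} {x : Option X} {y : Option Y}
    (f : OptionPair X Y → Option Z) (g : Option X → Option Y → Option Z)
    (hfg : ∀ p, f p = g p.1.1 p.1.2) (hg : g none none = none) :
    (optionPair x y).bind f = g x y := by
  unfold optionPair
  split_ifs with h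
  · simp [hfg]
  · simp only [ne_eq, not_not, Prod.mk.injEq] at h
    simp [h, hg]

theorem card_optionPair (X Y : Type) [Finite X] [Finite Y] :
    Nat.card (OptionPair X Y) = (Nat.card X + 1) * (Nat.card Y + 1) - 1 := by
  classical
  have := Fintype.ofFinite X
  have := Fintype.ofFinite Y
  simp [Nat.card_eq_fintype_card, Fintype.card_subtype_compl]

/-- The product automaton, which runs two automata in parallel as long as one is defined. -/
noncomputable def union (A₁ A₂ : SDTA α) : SDTA α where
  Q := OptionPair A₁.Q A₂.Q
  finite_Q := have := A₁.finite_Q; have := A₂.finite_Q; inferInstance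
  final := {p | (∃ q ∈ A₁.final, p.1.1 = some q) ∨ ∃ q ∈ A₂.final, p.1.2 = some q}
  S a := OptionPair (A₁.S a) (A₂.S a)
  finite_S a := have := A₁.finite_S a; have := A₂.finite_S a; inferInstance
  start a := ⟨(some (A₁.start a), some (A₂.start a)), by simp⟩
  step a c
    | .inl q => optionPair (c.1.1.bind fun c => q.1.1.bind fun q => A₁.step a c (.inl q))
        (c.1.2.bind fun c => q.1.2.bind fun q => A₂.step a c (.inl q))
    | .inr b => optionPair (c.1.1.bind fun c => A₁.step a c (.inr b))
        (c.1.2.bind fun c => A₂.step a c (.inr b))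
  out a c := optionPair (c.1.1.bind (A₁.out a)) (c.1.2.bind (A₂.out a))

theorem state_union (A₁ A₂ : SDTA α) (t : UTree α) :
    (A₁.union A₂).state t = optionPair (A₁.state t) (A₂.state t) := by
  have h0 : ∀ X Y : Type, optionPair (none : Option X) (none : Option Y) = none := fun X Y => by
    simp [optionPair]
  refine state_eq_of_simulation (B := A₁.union A₂) optionPair (fun _ => optionPair)
    (fun a => optionPair_eq_some_iff.2 rfl) ?_ ?_ ?_ t
  · intro a b c₁ c₂
    exact optionPair_bind _ (fun c₁ c₂ => optionPair (c₁.bind fun c => A₁.step a c (.inr b))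
      (c₂.bind fun c => A₂.step a c (.inr b))) (fun p => rfl) (h0 _ _)
  · intro a q₁ q₂ c₁ c₂
    refine optionPair_bind _ (fun c₁ c₂ =>
      optionPair (c₁.bind fun c => q₁.bind fun q => A₁.step a c (.inl q))
        (c₂.bind fun c => q₂.bind fun q => A₂.step a c (.inl q))) (fun p => ?_) (h0 _ _)
    exact optionPair_bind _ (fun q₁ q₂ =>
      optionPair (p.1.1.bind fun c => q₁.bind fun q => A₁.step a c (.inl q))
        (p.1.2.bind fun c => q₂.bind fun q => A₂.step a c (.inl q))) (fun _ => rfl)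
          (by simp [h0])
  · intro a c₁ c₂
    exact optionPair_bind _ (fun c₁ c₂ => optionPair (c₁.bind (A₁.out a))
      (c₂.bind (A₂.out a))) (fun p => rfl) (h0 _ _)

theorem language_union (A₁ A₂ : SDTA α) :
    (A₁.union A₂).language = A₁.language ∪ A₂.language := by
  ext t
  constructor
  · rintro ⟨p, hp, h⟩
    have h' := optionPair_eq_some_iff.1 ((state_union A₁ A₂ t).symm.trans h)
    change (∃ q ∈ A₁.final, p.1.1 = some q) ∨ ∃ q ∈ A₂.final, p.1.2 = some q at hp
    rw [h'] at hp
    exact hp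
  · intro h
    change (∃ q ∈ A₁.final, A₁.state t = some q) ∨ ∃ q ∈ A₂.final, A₂.state t = some q at h
    have hne : (A₁.state t, A₂.state t) ≠ (none, none) := by
      rintro hn
      simp only [Prod.mk.injEq] at hn
      simp [hn] at h
    exact ⟨⟨_, hne⟩, h, (state_union A₁ A₂ t).trans (optionPair_eq_some_iff.2 rfl)⟩

end Product

-- Counter automata and what they force on other automata

section Counter

/-- Nodes labeled `0` with only leaves as children are assigned the state `0` if the number of
children is divisible by `K`. A node labeled `i.succ` with a single child that has the state `q`
is assigned the state `q + d` if `op i = some d`, and no state if `op i = none`. -/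
def counter (m K : ℕ) [NeZero m] [NeZero K] (op : Fin 4 → Option (ZMod m)) : SDTA (Fin 5) where
  Q := ZMod m
  finite_Q := inferInstance
  final := {0}
  S := Fin.cases (ZMod K) fun _ => Option (ZMod m)
  finite_S := Fin.cases (inferInstanceAs (Finite (ZMod K)))
    fun _ => inferInstanceAs (Finite (Option (ZMod m)))
  -- For successor labels `none` is a genuine state, namely that before the child is read; it has no
  -- output, whereas `some q` outputs `q`.
  start := Fin.cases (0 : ZMod K) fun _ => (none : Option (ZMod m))
  step := Fin.cases (fun (c : ZMod K) x => x.elim (fun _ => none) fun _ => some (c + 1))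
    fun i (c : Option (ZMod m)) x =>
      c.elim (x.elim (fun q => (op i).map fun d => some (q + d)) fun _ => none) fun _ => none
  out := Fin.cases (fun c : ZMod K => if c = 0 then some 0 else none)
    fun _ (c : Option (ZMod m)) => c

/-- The state which the counter automaton assigns to a tree, as an element of `ZMod m`. -/
def counterState (m K : ℕ) [NeZero m] [NeZero K] (op : Fin 4 → Option (ZMod m))
    (t : UTree (Fin 5)) : Option (ZMod m) :=
  (counter m K op).state t

variable {m K : ℕ} [NeZero m] [NeZero K] {op : Fin 4 → Option (ZMod m)}

theorem mem_language_counter {t : UTree (Fin 5)} :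
    t ∈ (counter m K op).language ↔ counterState m K op t = some 0 :=
  exists_eq_left

theorem numVertical_counter : (counter m K op).numVertical = m :=
  Nat.card_zmod m

theorem numHorizontal_counter : (counter m K op).numHorizontal = K + 4 * (m + 1) := by
  have h0 : (counter m K op).numHorizontalAt 0 = K := Nat.card_zmod K
  have hs : ∀ i : Fin 4, (counter m K op).numHorizontalAt i.succ = m + 1 := fun i => by
    change Nat.card (Option (ZMod m)) = m + 1
    rw [Finite.card_option, Nat.card_zmod]
  rw [numHorizontal, Fin.sum_univ_succ, h0]
  simp [hs]

theorem state_counter_unary {t : UTree (Fin 5)} (ht : t.Branching) (i : Fin 4) :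
    counterState m K op (unary i.succ t) =
      (counterState m K op t).bind fun q => (op i).map fun d => q + d := by
  rw [counterState, unary, state_node, run_cons, letter_of_branching _ ht, run_nil,
    ← counterState]
  cases h : counterState m K op t with
  | none => rfl
  | some q =>
    change ((op i).map fun d => some (q + d)).bind id = (op i).map fun d => q + d
    cases op i <;> rfl

theorem state_counter_unary_none {t : UTree (Fin 5)} (ht : t.Branching) {i : Fin 4}
    (hi : op i = none) : counterState m K op (unary i.succ t) = none := by
  rw [state_counter_unary ht, hi]
  simp

theorem state_counter_unary_zero {t : UTree (Fin 5)} (ht : t.Branching) {i : Fin 4}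
    (hi : op i = some 0) :
    counterState m K op (unary i.succ t) = counterState m K op t := by
  rw [state_counter_unary ht, hi]
  simp

theorem state_counter_iterate_unary {t : UTree (Fin 5)} (ht : t.Branching) {i : Fin 4}
    {d : ZMod m} (hi : op i = some d) (p : ℕ) :
    counterState m K op ((unary i.succ)^[p] t) =
      (counterState m K op t).map fun q => q + p * d := by
  induction p with
  | zero => simp
  | succ p ih =>
    rw [Function.iterate_succ_apply', state_counter_unary (branching_iterate_unary _ ht p), ih, hi]
    cases counterState m K op t with
    | none => rfl
    | some q =>
      simp only [Option.map_some, Option.bind_some, Nat.cast_succ]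
      congr 1
      ring

theorem state_counter_broom (r : ℕ) : counterState m K op (broom 0 r) =
    if K ∣ r then some 0 else none := by
  have key : ∀ c : ZMod K, (counter m K op).run 0 (List.replicate r (.node 0 [])) (some c) =
      some (c + r : ZMod K) := by
    induction r with
    | zero =>
      intro c
      rw [List.replicate_zero, run_nil, Nat.cast_zero, add_zero]
      rfl
    | succ r ih =>
      intro c
      rw [List.replicate_succ, run_cons, letter_leaf]
      refine (ih (c + 1)).trans ?_
      congr 1
      push_cast
      ring
  rw [counterState, broom, state_node]
  refine (congrArg (Option.bind · _) (key 0)).trans ?_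
  rw [zero_add]
  change (if (r : ZMod K) = 0 then some 0 else none) = _
  simp only [ZMod.natCast_eq_zero_iff]

theorem state_counter_broom_mul_left (j : ℕ) :
    counterState m K op (broom 0 (K * j)) = some 0 := by
  simp [state_counter_broom]

/-- Adding −q moves exactly q to the final state 0, so this context tests for q; failure persists.
-/
theorem state_counter_iterate_neg {t : UTree (Fin 5)} (ht : t.Branching) {i : Fin 4}
    (hi : op i = some 1) (q : ZMod m) :
    counterState m K op ((unary i.succ)^[(-q).val] t) = some 0 ↔
      counterState m K op t = some q := by
  rw [state_counter_iterate_unary ht hi]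
  simp only [ZMod.natCast_val, ZMod.cast_id', id_eq, mul_one, Option.map_eq_some_iff,
    ← sub_eq_add_neg, sub_eq_zero, exists_eq_right]

theorem state_counter_iterate_zero {t : UTree (Fin 5)} (ht : t.Branching) {i : Fin 4}
    (hi : op i = some 0) (p : ℕ) :
    counterState m K op ((unary i.succ)^[p] t) = counterState m K op t := by
  rw [state_counter_iterate_unary ht hi]
  simp

theorem exists_state_counter_eq {t : UTree (Fin 5)} (ht : t.Branching)
    (h : counterState m K op t = some 0) {i j : Fin 4} (hi : op i = some 1)
    (hj : op j = none) (o : Option (ZMod m)) :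
    ∃ (l : Fin 4) (p : ℕ), (l = i ∨ l = j) ∧
      counterState m K op ((unary l.succ)^[p] t) = o := by
  cases o with
  | none => exact ⟨j, 1, .inr rfl, state_counter_unary_none ht hj⟩
  | some q =>
    refine ⟨i, q.val, .inl rfl, ?_⟩
    rw [state_counter_iterate_unary ht hi, h]
    simp

variable {n L : ℕ} [NeZero n] [NeZero L] {op' : Fin 4 → Option (ZMod n)}

/-- If one label increments the first counter and another one makes the second automaton fail
but preserves the first counter, then the states of an automaton for the union determine the
states of the first automaton. -/
theorem state_counter_eq_of_language_union {B : SDTA (Fin 5)}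
    (hB : B.language = (counter m K op).language ∪ (counter n L op').language) {i j : Fin 4}
    (hi : op i = some 1) (hj : op j = some 0) (hj' : op' j = none)
    (hi' : op' i = some 0) {t t' : UTree (Fin 5)}
    (ht : t.Branching) (ht' : t'.Branching) (h : B.state t = B.state t') :
    counterState m K op t = counterState m K op t' := by
  -- The inner label `j` silences the second automaton; the increments then test the first for `q`.
  have key : ∀ (u : UTree (Fin 5)) (q : ZMod m), u.Branching →
      ((unary i.succ)^[(-q).val] (unary j.succ u) ∈ B.language ↔
        counterState m K op u = some q) := by
    intro u q hu
    have hu' := branching_unary j.succ u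
    rw [hB, Set.mem_union, mem_language_counter, mem_language_counter,
      state_counter_iterate_neg hu' hi, state_counter_unary_zero hu hj,
      state_counter_iterate_zero hu' hi', state_counter_unary_none hu hj']
    simp
  refine Option.ext fun q => ?_
  rw [← key t q ht, ← key t' q ht']
  exact B.mem_language_congr (B.state_iterate_unary_congr _ (branching_unary _ _)
    (branching_unary _ _) (B.state_unary_congr _ ht ht' h) _)

/-- Independent increments test both counters at once. If either automaton fails, all these tests
reject, so only the combined optional pair is determined. -/
theorem map₂_state_counter_eq_of_language_inter {B : SDTA (Fin 5)}
    (hB : B.language = (counter m K op).language ∩ (counter n L op').language) {i j : Fin 4}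
    (hi : op i = some 1) (hj : op j = some 0) (hi' : op' i = some 0) (hj' : op' j = some 1)
    {t t' : UTree (Fin 5)} (ht : t.Branching) (ht' : t'.Branching) (h : B.state t = B.state t') :
    Option.map₂ Prod.mk (counterState m K op t) (counterState n L op' t) =
      Option.map₂ Prod.mk (counterState m K op t') (counterState n L op' t') := by
  have key : ∀ (u : UTree (Fin 5)) (q : ZMod m) (r : ZMod n), u.Branching →
      ((unary i.succ)^[(-q).val] ((unary j.succ)^[(-r).val] u) ∈ B.language ↔
        counterState m K op u = some q ∧ counterState n L op' u = some r) := by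
    intro u q r hu
    have hu' := branching_iterate_unary j.succ hu (-r).val
    rw [hB, Set.mem_inter_iff, mem_language_counter, mem_language_counter,
      state_counter_iterate_neg hu' hi, state_counter_iterate_zero hu hj,
      state_counter_iterate_zero hu' hi', state_counter_iterate_neg hu hj']
  have aux : ∀ (o₁ : Option (ZMod m)) (o₂ : Option (ZMod n)) (p : ZMod m × ZMod n),
      Option.map₂ Prod.mk o₁ o₂ = some p ↔ o₁ = some p.1 ∧ o₂ = some p.2 := by
    rintro (_ | q) (_ | r) ⟨a, b⟩ <;> simp
  refine Option.ext fun p => ?_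
  refine (aux _ _ p).trans (Iff.trans ?_ (aux _ _ p).symm)
  rw [← key t p.1 p.2 ht, ← key t' p.1 p.2 ht']
  exact B.mem_language_congr (B.state_iterate_unary_congr _ (branching_iterate_unary _ ht _)
    (branching_iterate_unary _ ht' _) (B.state_iterate_unary_congr _ ht ht' h _) _)

/-- By coprimality both counters accept a broom exactly when KL divides its number of leaves. Hence
the prefixes of fewer than KL leaves lead to distinct, defined horizontal states. -/
theorem mul_le_numHorizontal_of_state_counter (hKL : K.Coprime L) {B : SDTA (Fin 5)} {j : Fin 4}
    (hj : op j = none)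
    (hB : ∀ t t' : UTree (Fin 5), t.Branching → t'.Branching → B.state t = B.state t' →
      Option.map₂ Prod.mk (counterState m K op t) (counterState n L op' t) =
        Option.map₂ Prod.mk (counterState m K op t') (counterState n L op' t')) :
    K * L ≤ B.numHorizontal := by
  have hpos : 0 < K * L := Nat.pos_of_ne_zero (mul_ne_zero (NeZero.ne K) (NeZero.ne L))
  have hbroom : ∀ r : ℕ, Option.map₂ Prod.mk (counterState m K op (broom 0 r))
      (counterState n L op' (broom 0 r)) =
        if K * L ∣ r then some ((0 : ZMod m), (0 : ZMod n)) else none := by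
    intro r
    have hdvd : K * L ∣ r ↔ K ∣ r ∧ L ∣ r :=
      ⟨fun h => ⟨dvd_of_mul_right_dvd h, dvd_of_mul_left_dvd h⟩,
        fun h => hKL.mul_dvd_of_dvd_of_dvd h.1 h.2⟩
    rw [state_counter_broom, state_counter_broom]
    simp only [hdvd]
    by_cases h₁ : K ∣ r <;> by_cases h₂ : L ∣ r <;> simp [h₁, h₂]
  let ρ : ℕ → Option (B.S 0) := fun r =>
    B.run 0 (List.replicate r (.node 0 [])) (some (B.start 0))
  have hρ : ∀ r s, B.state (broom 0 (r + s)) =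
      (B.run 0 (List.replicate s (.node 0 [])) (ρ r)).bind (B.out 0) := by
    intro r s
    rw [broom, state_node, run_replicate_add]
  have hsome : ∀ r : Fin (K * L), (ρ r).isSome := by
    intro r
    -- If the run died, the broom with KL leaves would have no state, and neither would its
    -- extension by the failing label `j`; but the invariant is defined on the former and undefined
    -- on the latter.
    by_contra hr
    rw [Option.not_isSome_iff_eq_none] at hr
    have hne : (broom (0 : Fin 5) (r + (K * L - r))).Branching := branching_broom 0 (by omega)
    have hnone : B.state (broom 0 (r + (K * L - r))) = none := by
      rw [hρ, hr]
      rfl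
    have h := hB _ _ hne (branching_unary j.succ _)
      (hnone.trans (B.state_unary_eq_none j.succ hne hnone).symm)
    rw [hbroom, state_counter_unary_none hne hj, Nat.add_sub_cancel' r.2.le] at h
    simp at h
  have hinj : Function.Injective fun r : Fin (K * L) => (ρ r).get (hsome r) := by
    intro r r' h
    have h' : ρ r = ρ r' := by
      rw [← Option.some_get (hsome r), ← Option.some_get (hsome r')]
      exact congrArg some h
    have hs : B.state (broom 0 (r + (K * L - r))) = B.state (broom 0 (r' + (K * L - r))) := by
      rw [hρ, hρ, h']
    have := hB _ _ (branching_broom 0 (by omega)) (branching_broom 0 (by omega)) hs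
    rw [hbroom, hbroom, Nat.add_sub_cancel' r.2.le, if_pos dvd_rfl] at this
    -- This number lies strictly between 0 and 2KL, so divisibility makes it KL and r' = r.
    have hd : K * L ∣ r' + (K * L - r) := by
      by_contra hd
      simp [hd] at this
    obtain ⟨e, he⟩ := hd
    have hr := r.2
    have hr' := r'.2
    have : e = 1 := by
      have h1 : 0 < e := Nat.pos_of_ne_zero fun h0 => by rw [h0] at he; omega
      have h2 : e < 2 := by
        by_contra h2
        have := Nat.mul_le_mul_left (K * L) (not_lt.1 h2)
        omega
      omega
    rw [this] at he
    exact Fin.ext (by omega)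
  have := B.finite_S 0
  calc K * L = Nat.card (Fin (K * L)) := by simp
    _ ≤ B.numHorizontalAt 0 := Nat.card_le_card_of_injective _ hinj
    _ ≤ B.numHorizontal :=
      Finset.single_le_sum (f := B.numHorizontalAt) (fun _ _ => Nat.zero_le _) (Finset.mem_univ 0)

end Counter

-- The two witness languages and their lower bounds

section LowerBound

/-- The first label increments the counter, the second one preserves it, the third one makes the
automaton fail and the fourth one preserves the counter. -/
def opLeft (m : ℕ) : Fin 4 → Option (ZMod m) := ![some 1, some 0, none, some 0]

/-- The labels of `opLeft` with the first and second label as well as the third and fourth label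
exchanged. -/
def opRight (n : ℕ) : Fin 4 → Option (ZMod n) := ![some 0, some 1, some 0, none]

variable {m n K L : ℕ} [NeZero m] [NeZero n] [NeZero K] [NeZero L]

/-- The broom with KL leaves starts both counters at 0. Labels affecting one counter preserve the
other, so the components are set one after the other. -/
theorem exists_state_counter_eq_prod (o : Option (ZMod m) × Option (ZMod n)) :
    ∃ t : UTree (Fin 5), t.Branching ∧
      (counterState m K (opLeft m) t, counterState n L (opRight n) t) = o := by
  obtain ⟨o₁, o₂⟩ := o
  have hb : (broom (0 : Fin 5) (K * L)).Branching :=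
    branching_broom 0 (mul_ne_zero (NeZero.ne K) (NeZero.ne L))
  obtain ⟨l, p, hl, h⟩ := exists_state_counter_eq (op := opLeft m) hb
    (state_counter_broom_mul_left L) (i := 0) (j := 2) rfl rfl o₁
  have h0 : counterState n L (opRight n) ((unary l.succ)^[p] (broom 0 (K * L))) =
      some 0 := by
    rw [state_counter_iterate_zero hb (by rcases hl with rfl | rfl <;> rfl), mul_comm]
    exact state_counter_broom_mul_left K
  have hb' := branching_iterate_unary l.succ hb p
  obtain ⟨l', p', hl', h'⟩ := exists_state_counter_eq (op := opRight n) hb' h0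
    (i := 1) (j := 3) rfl rfl o₂
  refine ⟨_, branching_iterate_unary l'.succ hb' p', Prod.ext ?_ h'⟩
  exact (state_counter_iterate_zero hb' (by rcases hl' with rfl | rfl <;> rfl) _).trans h

theorem le_of_language_eq_union (hKL : K.Coprime L) {B : SDTA (Fin 5)}
    (hB : B.language =
      (counter m K (opLeft m)).language ∪ (counter n L (opRight n)).language) :
    (m + 1) * (n + 1) - 1 ≤ B.numVertical ∧ K * L ≤ B.numHorizontal := by
  have key : ∀ t t' : UTree (Fin 5), t.Branching → t'.Branching → B.state t = B.state t' →
      (counterState m K (opLeft m) t, counterState n L (opRight n) t) =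
        (counterState m K (opLeft m) t', counterState n L (opRight n) t') := by
    intro t t' ht ht' h
    exact Prod.ext
      (state_counter_eq_of_language_union hB (i := 0) (j := 3) rfl rfl rfl rfl ht ht' h)
      -- The same argument with the roles of the automata exchanged.
      (state_counter_eq_of_language_union (hB.trans (Set.union_comm _ _)) (i := 1) (j := 2)
        rfl rfl rfl rfl ht ht' h)
  constructor
  · have h := B.card_le_numVertical_add_one (β := Option (ZMod m) × Option (ZMod n)) _
      exists_state_counter_eq_prod key
    rw [Nat.card_prod, Finite.card_option, Finite.card_option, Nat.card_zmod, Nat.card_zmod] at h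
    omega
  · refine mul_le_numHorizontal_of_state_counter (op := opLeft m) (op' := opRight n) hKL (j := 2)
      rfl fun t t' ht ht' h => ?_
    have h' := Prod.ext_iff.1 (key t t' ht ht' h)
    exact congrArg₂ _ h'.1 h'.2

theorem le_of_language_eq_inter (hKL : K.Coprime L) {B : SDTA (Fin 5)}
    (hB : B.language =
      (counter m K (opLeft m)).language ∩ (counter n L (opRight n)).language) :
    m * n ≤ B.numVertical ∧ K * L ≤ B.numHorizontal := by
  have key := fun (t t' : UTree (Fin 5)) (ht : t.Branching) (ht' : t'.Branching) =>
    map₂_state_counter_eq_of_language_inter hB (i := 0) (j := 1) rfl rfl rfl rfl ht ht'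
  refine ⟨?_, mul_le_numHorizontal_of_state_counter hKL (j := 2) rfl key⟩
  -- The invariant has mn + 1 values, failure being one of them.
  have h := B.card_le_numVertical_add_one (β := Option (ZMod m × ZMod n)) _ (fun o => ?_) key
  · rw [Finite.card_option, Nat.card_prod, Nat.card_zmod, Nat.card_zmod] at h
    omega
  · obtain ⟨t, ht, h⟩ := exists_state_counter_eq_prod (K := K) (L := L)
      (o.map Prod.fst, o.map Prod.snd)
    rw [Prod.ext_iff] at h
    refine ⟨t, ht, (congrArg₂ _ h.1 h.2).trans ?_⟩
    cases o <;> rfl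

end LowerBound

end SDTA

theorem theorem3p1 :
    -- upper bounds for union and intersection
    (∀ (α : Type*) [Fintype α] (A₁ A₂ : SDTA α),
      (∃ B : SDTA α, B.language = A₁.language ∪ A₂.language ∧
        B.numVertical ≤ (A₁.numVertical + 1) * (A₂.numVertical + 1) - 1 ∧
        B.numHorizontal ≤
          ∑ a, ((A₁.numHorizontalAt a + 1) * (A₂.numHorizontalAt a + 1) - 1)) ∧
      (∃ B : SDTA α, B.language = A₁.language ∩ A₂.language ∧
        B.numVertical ≤ A₁.numVertical * A₂.numVertical ∧
        B.numHorizontal ≤ ∑ a, A₁.numHorizontalAt a * A₂.numHorizontalAt a)) ∧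
    -- lower bounds: one fixed alphabet with `s` letters and one constant `c` for all `m`, `n`, `k`
    (∃ s c : ℕ, ∀ (m n : ℕ) (k : ℕ → ℕ), 1 ≤ m → 1 ≤ n →
      (∀ i ∈ Finset.Icc 1 (m + n), 1 ≤ k i) →
      (∀ i ∈ Finset.Icc 1 (m + n), ∀ j ∈ Finset.Icc 1 (m + n), i ≠ j → (k i).Coprime (k j)) →
      ∃ T₁ T₂ : Set (UTree (Fin s)),
        (∃ A₁ : SDTA (Fin s), A₁.language = T₁ ∧ A₁.numVertical = m ∧
          |(A₁.numHorizontal : ℤ) - ∏ i ∈ Finset.Icc 1 m, (k i : ℤ)| ≤ c * m) ∧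
        (∃ A₂ : SDTA (Fin s), A₂.language = T₂ ∧ A₂.numVertical = n ∧
          |(A₂.numHorizontal : ℤ) - ∏ i ∈ Finset.Icc (m + 1) (m + n), (k i : ℤ)| ≤ c * n) ∧
        (∀ B : SDTA (Fin s), B.language = T₁ ∪ T₂ →
          (m + 1) * (n + 1) - 1 ≤ B.numVertical ∧
          ∏ i ∈ Finset.Icc 1 (m + n), k i ≤ B.numHorizontal) ∧
        (∀ B : SDTA (Fin s), B.language = T₁ ∩ T₂ →
          m * n ≤ B.numVertical ∧
          ∏ i ∈ Finset.Icc 1 (m + n), k i ≤ B.numHorizontal)) := by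
  refine ⟨fun α _ A₁ A₂ => ⟨⟨A₁.union A₂, SDTA.language_union A₁ A₂, ?_, ?_⟩,
    ⟨A₁.inter A₂, SDTA.language_inter A₁ A₂, ?_, ?_⟩⟩, 5, 8, ?_⟩
  · have := A₁.finite_Q
    have := A₂.finite_Q
    exact (SDTA.card_optionPair A₁.Q A₂.Q).le
  · refine Finset.sum_le_sum fun a _ => ?_
    have := A₁.finite_S a
    have := A₂.finite_S a
    exact (SDTA.card_optionPair (A₁.S a) (A₂.S a)).le
  · exact (Nat.card_prod A₁.Q A₂.Q).le
  · exact Finset.sum_le_sum fun a _ => (Nat.card_prod (A₁.S a) (A₂.S a)).le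
  · intro m n k hm hn hk hcop
    have hprod : (∏ i ∈ Finset.Icc 1 m, k i) * ∏ i ∈ Finset.Icc (m + 1) (m + n), k i =
        ∏ i ∈ Finset.Icc 1 (m + n), k i := by
      have hIcc : ∀ a b : ℕ, Finset.Icc (a + 1) b = Finset.Ioc a b := fun a b => by
        ext i
        simp
      rw [hIcc m, hIcc 0, hIcc 0]
      exact Finset.prod_Ioc_consecutive k (Nat.zero_le m) (Nat.le_add_right m n)
    have hKL : (∏ i ∈ Finset.Icc 1 m, k i).Coprime (∏ i ∈ Finset.Icc (m + 1) (m + n), k i) := by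
      refine Nat.Coprime.prod_left fun i hi => Nat.Coprime.prod_right fun j hj => ?_
      rw [Finset.mem_Icc] at hi hj
      exact hcop i (Finset.mem_Icc.2 (by omega)) j (Finset.mem_Icc.2 (by omega)) (by omega)
    rw [← hprod]
    simp only [← Nat.cast_prod]
    have hne : (∏ i ∈ Finset.Icc 1 m, k i) * ∏ i ∈ Finset.Icc (m + 1) (m + n), k i ≠ 0 := by
      rw [hprod, Finset.prod_ne_zero_iff]
      exact fun i hi => Nat.one_le_iff_ne_zero.1 (hk i hi)
    -- From here on, only that the two products are coprime and nonzero matters.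
    generalize ∏ i ∈ Finset.Icc 1 m, k i = K at *
    generalize ∏ i ∈ Finset.Icc (m + 1) (m + n), k i = L at *
    have : NeZero m := ⟨by omega⟩
    have : NeZero n := ⟨by omega⟩
    have : NeZero K := ⟨left_ne_zero_of_mul hne⟩
    have : NeZero L := ⟨right_ne_zero_of_mul hne⟩
    refine ⟨_, _, ⟨SDTA.counter m K (SDTA.opLeft m), rfl, SDTA.numVertical_counter, ?_⟩,
      ⟨SDTA.counter n L (SDTA.opRight n), rfl, SDTA.numVertical_counter, ?_⟩,
      fun B hB => SDTA.le_of_language_eq_union hKL hB,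
      fun B hB => SDTA.le_of_language_eq_inter hKL hB⟩
    -- The excess over K is 4(m + 1), at most 8m because m ≥ 1; this is the origin of the constant
    -- 8.
    · rw [SDTA.numHorizontal_counter, abs_le]
      push_cast
      omega
    · rw [SDTA.numHorizontal_counter, abs_le]
      push_cast
      omega
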